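/- Let $G$ be a finite directed acyclic graph with vertex set $V$. A \emph{trek} from $i$ to $j$ in $G$ is a simple path $P$ from $i$ to $j$ in the underlying undirected graph that does not contain two distinct edges $x\to z$, $y\to z$ with the same head; it goes up, against the direction of the edges, from $i$ to a unique topmost vertex $\mathrm{top}(P)$ and then down to $j$. The vertices of $P$ between $i$ and $\mathrm{top}(P)$ form its $i$-side and those between $\mathrm{top}(P)$ and $j$ form its $j$-side; $\mathrm{top}(P)$ belongs to both sides. For $i=j$ the only trek is the empty one. Let $\phi_G:\mathbb{C}[\sigma_{ij}\mid i,j\in V]\to\mathbb{C}[a_v,\lambda_{kl}\mid v\in V,\ k\to l \text{ an edge of } G]$, where $\sigma_{ij}=\sigma_{ji}$, be the $\mathbb{C}$-algebra homomorphism with $$\phi_G(\sigma_{ij})=\sum_{P \text{ a trek from } i \text{ to } j} a_{\mathrm{top}(P)}\prod_{k\to l\,\in P}\lambda_{kl}.$$ Put $I_G=\ker\phi_G$ and, for a set $O\subseteq V$ of observed vertices, $I_{G,O}=I_G\cap\mathbb{C}[\sigma_{ij}\mid i,j\in O]$. A vertex $c$ is a \emph{choke point} between sets $I,J\subseteq V$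 if every trek from a point of $I$ to a point of $J$ contains $c$ and either $c$ is on the $I$-side of all these treks or $c$ is on the $J$-side of all these treks. Let $T$ be a rooted directed tree, that is, a finite directed acyclic graph whose underlying undirected graph is a tree and all of whose edges are directed away from a given root vertex, and let $O$ be the set of leaves of $T$ (the vertices without children). Then $I_{T,O}$ is the ideal of $\mathbb{C}[\sigma_{ij}\mid i,j\in O]$ generated by the quadratic tetrads $$\sigma_{ik}\sigma_{jl}-\sigma_{il}\sigma_{kj}$$ with $i,j,k,l\in O$ (not necessarily distinct) such that there is a choke point in $T$ between $\{i,j\}$ and $\{k,l\}$. -/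

import Mathlib

open MvPolynomial

noncomputable section

namespace GaussianNetwork

variable {V : Type*}

/-- No directed cycles (in particular no loops and no pair of opposite edges). -/
def IsAcyclic (G : Digraph V) : Prop :=
  ∀ v, ¬ Relation.TransGen G.Adj v v

/-- A directed tree with root `r`: a directed acyclic graph whose underlying undirected graph is a
tree and all of whose edges point away from `r`. -/
structure IsRootedDirectedTree (G : Digraph V) (r : V) : Prop where
  acyclic : IsAcyclic G
  isTree : G.toSimpleGraphInclusive.IsTree
  away : ∀ u v, G.Adj u v →
    G.toSimpleGraphInclusive.dist r v = G.toSimpleGraphInclusive.dist r u + 1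

/-- The leaves of a rooted directed tree: the vertices without children. -/
def leaves (G : Digraph V) : Set V := {v | ∀ w, ¬ G.Adj v w}

/-- A path contains a collider if it uses two different edges `x → z` and `y → z` with the same
head. -/
def HasCollider (G : Digraph V) {i j : V} (p : G.toSimpleGraphInclusive.Walk i j) : Prop :=
  ∃ x y z, x ≠ y ∧ G.Adj x z ∧ G.Adj y z ∧ s(x, z) ∈ p.edges ∧ s(y, z) ∈ p.edges

/-- The treks from `i` to `j`: simple paths (of any edge directions) without a collider. -/
def Trek (G : Digraph V) (i j : V) : Type _ :=
  {p : G.toSimpleGraphInclusive.Walk i j // p.IsPath ∧ ¬ HasCollider G p}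

namespace Trek

variable {G : Digraph V} {i j : V}

/-- `c` lies on the `i`-side of the trek `P` from `i` to `j`: going along `P` from `i` to `c`, every
edge is traversed upwards, against its direction. The top of `P` lies on both sides. -/
def OnLeftSide (P : Trek G i j) (c : V) : Prop :=
  ∃ (p : G.toSimpleGraphInclusive.Walk i c) (q : G.toSimpleGraphInclusive.Walk c j),
    P.1 = p.append q ∧ ∀ d ∈ p.darts, G.Adj d.snd d.fst

/-- `c` lies on the `j`-side of the trek `P` from `i` to `j`: going along `P` from `c` to `j`, every
edge is traversed downwards, in its direction. The top of `P` lies on both sides. -/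
def OnRightSide (P : Trek G i j) (c : V) : Prop :=
  ∃ (p : G.toSimpleGraphInclusive.Walk i c) (q : G.toSimpleGraphInclusive.Walk c j),
    P.1 = p.append q ∧ ∀ d ∈ q.darts, G.Adj d.fst d.snd

/-- `t` is the topmost vertex of `P`: the trek goes up from `i` to `t` and then down to `j`. -/
def IsTop (P : Trek G i j) (t : V) : Prop :=
  P.OnLeftSide t ∧ P.OnRightSide t

/-- The topmost vertex of a trek; in an acyclic graph it exists and is unique, see
`existsUnique_isTop`. -/
def top (P : Trek G i j) : V :=
  @Classical.epsilon V ⟨i⟩ P.IsTop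

/-- The same trek, traversed from `j` to `i`. -/
def reverse (P : Trek G i j) : Trek G j i :=
  ⟨P.1.reverse, P.2.1.reverse, fun ⟨x, y, z, h⟩ => P.2.2 ⟨x, y, z, by simpa using h⟩⟩

theorem reverse_reverse (P : Trek G i j) : P.reverse.reverse = P :=
  Subtype.ext (SimpleGraph.Walk.reverse_reverse _)

theorem OnLeftSide.reverse {P : Trek G i j} {c : V} (h : P.OnLeftSide c) :
    P.reverse.OnRightSide c := by
  obtain ⟨p, q, h1, h2⟩ := h
  refine ⟨q.reverse, p.reverse, ?_, ?_⟩
  · change P.1.reverse = _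
    rw [h1, SimpleGraph.Walk.reverse_append]
  · intro d hd
    simpa using h2 d.symm (by simpa using hd)

theorem OnRightSide.reverse {P : Trek G i j} {c : V} (h : P.OnRightSide c) :
    P.reverse.OnLeftSide c := by
  obtain ⟨p, q, h1, h2⟩ := h
  refine ⟨q.reverse, p.reverse, ?_, ?_⟩
  · change P.1.reverse = _
    rw [h1, SimpleGraph.Walk.reverse_append]
  · intro d hd
    simpa using h2 d.symm (by simpa using hd)

theorem isTop_reverse (P : Trek G i j) : P.reverse.IsTop = P.IsTop := by
  funext t
  refine propext ⟨fun h => ?_, fun h => ⟨h.2.reverse, h.1.reverse⟩⟩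
  have h' : P.reverse.reverse.IsTop t := ⟨h.2.reverse, h.1.reverse⟩
  rwa [reverse_reverse] at h'

theorem top_reverse (P : Trek G i j) : P.reverse.top = P.top := by
  unfold top
  rw [isTop_reverse]

instance instFinite [Finite V] : Finite (Trek G i j) := by
  classical
  have := Fintype.ofFinite V
  exact Finite.of_injective
    (fun P : Trek G i j => (⟨P.1, P.2.1⟩ : G.toSimpleGraphInclusive.Path i j))
    (fun P Q h => Subtype.ext (show P.1 = Q.1 from Subtype.mk.inj h))

instance instFintype [Finite V] : Fintype (Trek G i j) := Fintype.ofFinite _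

end Trek

/-- In an acyclic graph every trek has exactly one topmost vertex. -/
theorem existsUnique_isTop {G : Digraph V} (hG : IsAcyclic G) {i j : V} (P : Trek G i j) :
    ∃! t, P.IsTop t := by
  have asymm : ∀ {u v : V}, G.Adj u v → ¬ G.Adj v u := fun h h' =>
    hG _ ((Relation.TransGen.single h).tail h')
  obtain ⟨p, hp, hc⟩ := P
  induction p with
  | nil =>
    refine ⟨_, ⟨⟨.nil, .nil, rfl, by simp⟩, ⟨.nil, .nil, rfl, by simp⟩⟩, ?_⟩
    rintro t ⟨⟨q, s, h, -⟩, -⟩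
    cases q with
    | nil => rfl
    | cons h' q => simp at h
  | @cons u v w h p ih =>
    have hp' := SimpleGraph.Walk.cons_isPath_iff h p |>.1 hp
    have hc' : ¬ HasCollider G p := fun ⟨x, y, z, h1, h2, h3, h4, h5⟩ =>
      hc ⟨x, y, z, h1, h2, h3, by simp [h4], by simp [h5]⟩
    obtain ⟨t, ⟨ht1, ht2⟩, hu⟩ := ih hp'.1 hc'
    rcases h.2 with huv | hvu
    · -- The first edge goes down, so the top is `u`.
      refine ⟨u, ⟨⟨.nil, _, rfl, by simp⟩, ⟨.nil, _, rfl, ?_⟩⟩, ?_⟩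
      · have htv : t = v := by
          obtain ⟨q, s, hq, hd⟩ := ht1
          cases q with
          | nil => rfl
          | @cons _ x _ h' q =>
            exfalso
            have hq : p = .cons h' (q.append s) := hq
            have hxv : G.Adj x v := hd ⟨(v, x), h'⟩ (by simp)
            refine hc ⟨u, x, v, ?_, huv, hxv, by simp, ?_⟩
            · rintro rfl
              exact hp'.2 (by rw [hq]; simp)
            · rw [hq, Sym2.eq_swap]; simp
        subst htv
        obtain ⟨q, s, hq, hd⟩ := ht2
        have hqn : q = .nil := by
          have h1 : q.IsPath := by
            have := hp'.1
            change p = _ at hq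
            rw [hq] at this
            exact this.of_append_left
          exact SimpleGraph.Walk.eq_nil_iff_nil.2 (SimpleGraph.Walk.isPath_iff_nil.1 h1)
        subst hqn
        have hq : p = s := hq
        subst hq
        intro d hd'
        rw [SimpleGraph.Walk.darts_cons, List.mem_cons] at hd'
        rcases hd' with rfl | hd'
        · exact huv
        · exact hd d hd'
      · rintro t' ⟨⟨q, s, hq, hd⟩, -⟩
        cases q with
        | nil => rfl
        | @cons _ x _ h' q =>
          have hq : SimpleGraph.Walk.cons h p = .cons h' (q.append s) := hq
          have hx : v = x := (SimpleGraph.Walk.cons.inj hq).1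
          subst hx
          exact absurd (hd ⟨(u, v), h'⟩ (by simp)) (asymm huv)
    · refine ⟨t, ⟨?_, ?_⟩, ?_⟩
      · obtain ⟨q, s, hq, hd⟩ := ht1
        have hq : p = q.append s := hq
        refine ⟨.cons h q, s, congrArg (SimpleGraph.Walk.cons h) hq, ?_⟩
        intro d hd'
        rw [SimpleGraph.Walk.darts_cons, List.mem_cons] at hd'
        rcases hd' with rfl | hd'
        · exact hvu
        · exact hd d hd'
      · obtain ⟨q, s, hq, hd⟩ := ht2
        have hq : p = q.append s := hq
        exact ⟨.cons h q, s, congrArg (SimpleGraph.Walk.cons h) hq, hd⟩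
      · rintro t' ⟨⟨q, s, hq, hd⟩, ⟨q', s', hq', hd'⟩⟩
        have key : Trek.OnRightSide (⟨p, hp'.1, hc'⟩ : Trek G v w) t' := by
          cases q' with
          | nil =>
            have hq' : SimpleGraph.Walk.cons h p = s' := hq'
            subst hq'
            exact absurd (hd' ⟨(u, v), h⟩ (by simp)) (asymm hvu)
          | @cons _ x _ h' q' =>
            have hq' : SimpleGraph.Walk.cons h p = .cons h' (q'.append s') := hq'
            obtain ⟨hx, hy⟩ := SimpleGraph.Walk.cons.inj hq'
            subst hx
            exact ⟨q', s', eq_of_heq hy, hd'⟩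
        refine hu t' ⟨?_, key⟩
        cases q with
        | nil =>
          exfalso
          obtain ⟨q1, s1, h1, -⟩ := key
          have h1 : p = q1.append s1 := h1
          exact hp'.2 (by rw [h1]; simp)
        | @cons _ x _ h' q =>
          have hq : SimpleGraph.Walk.cons h p = .cons h' (q.append s) := hq
          obtain ⟨hx, hy⟩ := SimpleGraph.Walk.cons.inj hq
          subst hx
          exact ⟨q, s, eq_of_heq hy, fun d hd1 => hd d (by simp [hd1])⟩

/-- The directed edges of `G`. -/
abbrev Edge (G : Digraph V) : Type _ := {e : V × V // G.Adj e.1 e.2}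

/-- The ring `ℂ[a, λ]`: one indeterminate `a_v` for each vertex and one indeterminate `λ_{kl}` for
each edge `k → l`. -/
abbrev ParamRing (G : Digraph V) : Type _ := MvPolynomial (V ⊕ Edge G) ℂ

/-- The monomial of a trek `P`: the product of `a_{top(P)}` and of all `λ_{kl}` with `k → l` an edge
of `P`. -/
def trekMonomial [Fintype V] {G : Digraph V} {i j : V} (P : Trek G i j) : ParamRing G :=
  open Classical in
  X (Sum.inl P.top) * ∏ e : Edge G with s(e.1.1, e.1.2) ∈ P.1.edges, X (Sum.inr e)

/-- The polynomial `σ_{ij}(a, λ)`, the sum of the monomials of all treks from `i` to `j`. -/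
def trekPolynomial [Fintype V] (G : Digraph V) (i j : V) : ParamRing G :=
  ∑ P : Trek G i j, trekMonomial P

theorem trekPolynomial_comm [Fintype V] (G : Digraph V) (i j : V) :
    trekPolynomial G i j = trekPolynomial G j i := by
  unfold trekPolynomial
  refine Fintype.sum_equiv
    ⟨Trek.reverse, Trek.reverse, Trek.reverse_reverse, Trek.reverse_reverse⟩ _ _ fun P => ?_
  simp only [Equiv.coe_fn_mk, trekMonomial, Trek.top_reverse]
  classical
  congr 1
  refine Finset.prod_congr (Finset.filter_congr fun e _ => ?_) fun _ _ => rfl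
  change _ ↔ _ ∈ P.1.reverse.edges
  rw [SimpleGraph.Walk.edges_reverse, List.mem_reverse]

/-- The trek rule homomorphism `φ_G : ℂ[σ] → ℂ[a, λ]`, sending `σ_{ij}` to `σ_{ij}(a, λ)`. The
indeterminates `σ_{ij} = σ_{ji}` are indexed by unordered pairs (with `i = j` allowed). -/
def trekHom [Fintype V] (G : Digraph V) : MvPolynomial (Sym2 V) ℂ →ₐ[ℂ] ParamRing G :=
  aeval (Sym2.lift ⟨trekPolynomial G, trekPolynomial_comm G⟩)

/-- The ideal `I_G = ker φ_G` of the Gaussian Bayesian network of `G`. -/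
def networkIdeal [Fintype V] (G : Digraph V) : Ideal (MvPolynomial (Sym2 V) ℂ) :=
  RingHom.ker (trekHom G)

/-- The ideal `I_{G,O} = I_G ∩ ℂ[σ_{ij} | i, j ∈ O]` of the network with observed vertices `O`, as an
ideal of the polynomial ring in the `σ_{ij}` with `i, j ∈ O`. -/
def observedIdeal [Fintype V] (G : Digraph V) (O : Set V) : Ideal (MvPolynomial (Sym2 O) ℂ) :=
  (networkIdeal G).comap (rename (Sym2.map ((↑) : O → V)) :
    MvPolynomial (Sym2 O) ℂ →ₐ[ℂ] MvPolynomial (Sym2 V) ℂ)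

/-- `c` is a choke point between `I` and `J`: every trek from a point of `I` to a point of `J`
contains `c`, and either `c` is on the `I`-side of all of them or on the `J`-side of all of them. -/
def IsChokePoint (G : Digraph V) (c : V) (I J : Set V) : Prop :=
  (∀ i ∈ I, ∀ j ∈ J, ∀ P : Trek G i j, c ∈ P.1.support) ∧
    ((∀ i ∈ I, ∀ j ∈ J, ∀ P : Trek G i j, P.OnLeftSide c) ∨
      (∀ i ∈ I, ∀ j ∈ J, ∀ P : Trek G i j, P.OnRightSide c))

/-- The tetrad `σ_{ik} σ_{jl} - σ_{il} σ_{kj}`. -/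
def tetrad {O : Type*} (i j k l : O) : MvPolynomial (Sym2 O) ℂ :=
  X s(i, k) * X s(j, l) - X s(i, l) * X s(k, j)

end GaussianNetwork

end

/-!
Between two vertices of a rooted tree there is exactly one trek, so `φ_T` maps every `σ_{ij}` to a
monomial, and the kernel of a monomial homomorphism is spanned by differences of monomials with the
same image. View a monomial in the `σ_{ij}` as a multigraph on the leaves. Its image records, for
every vertex `w`, how many edges join the leaves below `w` to the other leaves, and for every leaf
how many loops it carries. It has to be shown that two multigraphs with the same record are
connected by tetrad moves.

Choose a lowest vertex `v` such that an edge `{i, j}` of one of the two multigraphs lies entirely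
below `v`. If `v` is a leaf, then the other multigraph has the same loop. Otherwise every edge which
meets the leaves below `v` joins two different branches at `v`, so that `v` is a choke point for the
exchange of ends between such edges. The records prescribe the degree of every branch, and the
handshake lemma ensures that the other multigraph has enough edges for exchanges which create
`{i, j}`. Cancel the common edge and repeat.
-/

noncomputable section

namespace GaussianNetwork

section MarkovBasis

variable {σ τ N R : Type*}

/-- The weight of a multiset over `σ` whose element `s` has weight `f s`: the additive extension of
`f` to the free commutative monoid on `σ`. -/
def weight [AddCommMonoid N] (f : σ → N) : Multiset σ →+ N :=
  Multiset.sumAddMonoidHom.comp (Multiset.mapAddMonoidHom f)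

theorem weight_singleton [AddCommMonoid N] (f : σ → N) (s : σ) : weight f {s} = f s := by
  simp [weight]

theorem weight_cons [AddCommMonoid N] (f : σ → N) (s : σ) (M : Multiset σ) :
    weight f (s ::ₘ M) = f s + weight f M := by
  simp [weight]

theorem weight_apply_eq_countP {f : σ → τ →₀ ℕ} {x : τ} {P : σ → Prop} [DecidablePred P]
    (hf : ∀ s, f s x = if P s then 1 else 0) (M : Multiset σ) : weight f M x = M.countP P := by
  induction M using Multiset.induction_on with
  | empty => simp
  | cons s M ih => rw [weight_cons, Finsupp.add_apply, ih, hf, Multiset.countP_cons, add_comm]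

theorem exists_addCon_cons_cons {c : AddCon (Multiset σ)} {s t s' t' : σ} {M : Multiset σ}
    (h : c {s, t} {s', t'}) (hs : s ∈ M) (ht : t ∈ M) (hst : s ≠ t) :
    ∃ K, M = s ::ₘ t ::ₘ K ∧ c M (s' ::ₘ t' ::ₘ K) := by
  obtain ⟨L, rfl⟩ := Multiset.exists_cons_of_mem hs
  obtain ⟨K, rfl⟩ := Multiset.exists_cons_of_mem ((Multiset.mem_cons.1 ht).resolve_left hst.symm)
  exact ⟨K, rfl, by simpa [Multiset.cons_add] using c.add h (c.refl K)⟩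

/-- Descent on the cardinality, in which the common element is cancelled. -/
theorem ker_weight_le_of_exists_common_mem [AddCommMonoid N] [IsLeftCancelAdd N] {f : σ → N}
    {c : AddCon (Multiset σ)} (hweight : c ≤ AddCon.ker (weight f))
    (hcard : c ≤ AddCon.ker Multiset.cardHom)
    (hcommon : ∀ M M', weight f M = weight f M' → M + M' ≠ 0 →
      ∃ s K K', c M (s ::ₘ K) ∧ c M' (s ::ₘ K')) :
    AddCon.ker (weight f) ≤ c := by
  intro M M' hMM'
  induction hn : M.card using Nat.strong_induction_on generalizing M M' with | _ n ih
  by_cases hzero : M + M' = 0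
  · obtain ⟨rfl, rfl⟩ := add_eq_zero.1 hzero
    exact c.refl 0
  obtain ⟨s, K, K', hK, hK'⟩ := hcommon M M' hMM' hzero
  have hKK' : weight f K = weight f K' := by
    have h : weight f (s ::ₘ K) = weight f (s ::ₘ K') :=
      (hweight hK).symm.trans (hMM'.trans (hweight hK'))
    rwa [weight_cons, weight_cons, add_right_inj] at h
  have hlt : K.card < n := by
    have h : M.card = (s ::ₘ K).card := hcard hK
    rw [Multiset.card_cons] at h
    omega
  have hcons : c (s ::ₘ K) (s ::ₘ K') := by
    simpa using c.add (c.refl {s}) (ih _ hlt hKK' rfl)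
  exact c.trans hK (c.trans hcons (c.symm hK'))

section CommSemiring

variable [CommSemiring R]

/-- The monomial `∏ X s` over the elements `s` of a multiset `M`, with multiplicity. -/
def multisetMonomial (R : Type*) [CommSemiring R] (M : Multiset σ) : MvPolynomial σ R :=
  (M.map X).prod

theorem multisetMonomial_add (M M' : Multiset σ) :
    multisetMonomial R (M + M') = multisetMonomial R M * multisetMonomial R M' := by
  simp [multisetMonomial]

theorem multisetMonomial_pair (s t : σ) : multisetMonomial R {s, t} = X s * X t := by
  simp [multisetMonomial]

theorem multisetMonomial_toMultiset (u : σ →₀ ℕ) :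
    multisetMonomial R (Finsupp.toMultiset u) = monomial u 1 := by
  rw [multisetMonomial, Finsupp.toMultiset_map, Finsupp.prod_toMultiset,
    Finsupp.prod_mapDomain_index (by simp) (by simp [pow_add]), monomial_eq, C_1, one_mul]

theorem aeval_multisetMonomial (f : σ → τ →₀ ℕ) (M : Multiset σ) :
    aeval (fun s => monomial (f s) (1 : R)) (multisetMonomial R M) = monomial (weight f M) 1 := by
  induction M using Multiset.induction_on with
  | empty => simp [multisetMonomial]
  | cons s M ih =>
    rw [← Multiset.singleton_add, multisetMonomial_add, map_mul, ih, map_add, weight_singleton,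
      multisetMonomial, Multiset.map_singleton, Multiset.prod_singleton, aeval_X, monomial_mul,
      mul_one]

end CommSemiring

variable [CommRing R]

/-- The congruence of an ideal: multisets are identified when their monomials agree modulo it. -/
def idealCon (J : Ideal (MvPolynomial σ R)) : AddCon (Multiset σ) where
  toSetoid := Setoid.ker fun M => Ideal.Quotient.mk J (multisetMonomial R M)
  add' {M M' K K'} h h' := by
    simp only [Setoid.ker_def, multisetMonomial_add, map_mul] at h h' ⊢
    rw [h, h']

theorem idealCon_iff {J : Ideal (MvPolynomial σ R)} {M M' : Multiset σ} :
    idealCon J M M' ↔ multisetMonomial R M - multisetMonomial R M' ∈ J :=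
  Ideal.Quotient.eq

/-- Modulo `J` a monomial depends only on its image, so the quotient map by `J` factors linearly
through the monomial homomorphism. -/
theorem ker_aeval_monomial_le {f : σ → τ →₀ ℕ} {J : Ideal (MvPolynomial σ R)}
    (hJ : AddCon.ker (weight f) ≤ idealCon J) :
    RingHom.ker (aeval fun s => monomial (f s) (1 : R)) ≤ J := by
  let φ : MvPolynomial σ R →ₐ[R] MvPolynomial τ R := aeval fun s => monomial (f s) 1
  let lift : MvPolynomial τ R →ₗ[R] MvPolynomial σ R ⧸ J := (basisMonomials τ R).constr R
    fun t => Ideal.Quotient.mk J (multisetMonomial R (Function.invFun (weight f) t))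
  have hlift (M : Multiset σ) :
      lift (monomial (weight f M) 1) = Ideal.Quotient.mk J (multisetMonomial R M) := by
    have h := (basisMonomials τ R).constr_basis R (fun t => Ideal.Quotient.mk J
      (multisetMonomial R (Function.invFun (weight f) t))) (weight f M)
    rw [coe_basisMonomials] at h
    exact h.trans (hJ (Function.invFun_eq ⟨M, rfl⟩))
  have hfactor : lift ∘ₗ φ.toLinearMap = (Ideal.Quotient.mkₐ R J).toLinearMap := by
    refine (basisMonomials σ R).ext fun u => ?_
    simp only [coe_basisMonomials, ← multisetMonomial_toMultiset]
    exact (congrArg lift (aeval_multisetMonomial f _)).trans (hlift _)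
  intro g hg
  have h : lift (φ g) = Ideal.Quotient.mk J g := LinearMap.congr_fun hfactor g
  rw [show φ g = 0 from hg, map_zero] at h
  exact Ideal.Quotient.eq_zero_iff_mem.1 h.symm

/-- One half of the Diaconis–Sturmfels theorem on Markov bases. -/
theorem ker_aeval_monomial_eq_span {f : σ → τ →₀ ℕ} {move : Multiset σ → Multiset σ → Prop}
    (hmove : addConGen move = AddCon.ker (weight f)) :
    RingHom.ker (aeval fun s => monomial (f s) (1 : R)) =
      Ideal.span {g | ∃ M M', move M M' ∧
        g = multisetMonomial R M - multisetMonomial R M'} := by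
  apply le_antisymm
  · refine ker_aeval_monomial_le (hmove ▸ AddCon.addConGen_le.2 fun M M' h => ?_)
    exact idealCon_iff.2 (Ideal.subset_span ⟨M, M', h, rfl⟩)
  · refine Ideal.span_le.2 ?_
    rintro g ⟨M, M', h, rfl⟩
    have hweight : weight f M = weight f M' := AddCon.addConGen_le.1 hmove.le _ _ h
    simp only [SetLike.mem_coe, RingHom.mem_ker, map_sub, aeval_multisetMonomial, hweight,
      sub_self]

end MarkovBasis

section Multigraph

variable {O β : Type*}

/-- The pair `p` joins different classes of the colouring `B`. For `B = (· ∈ S)` this says that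
exactly one end of `p` lies in `S`. A multiset of pairs is viewed as a multigraph, so that
`M.countP (Separates (B · = b))` is the degree of the class `b`, not counting loops. -/
def Separates (B : O → β) (p : Sym2 O) : Prop := ¬ (p.map B).IsDiag

theorem separates_mk {B : O → β} {x y : O} : Separates B s(x, y) ↔ B x ≠ B y := by
  simp [Separates]

theorem separates_mk_prop {P : O → Prop} {x y : O} : Separates P s(x, y) ↔ ¬ (P x ↔ P y) := by
  rw [separates_mk, Ne, eq_iff_iff]

theorem separates_of_separates_eq {B : O → β} {b : β} {p : Sym2 O} (h : Separates (B · = b) p) :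
    Separates B p := by
  induction p with | _ x y
  rw [separates_mk_prop] at h
  exact separates_mk.2 fun hxy => h (by rw [hxy])

open Classical in
theorem card_separates_eq [Fintype β] (B : O → β) (p : Sym2 O) :
    (Finset.univ.filter fun b => Separates (B · = b) p).card = if Separates B p then 2 else 0 := by
  induction p with | _ x y
  split_ifs with h <;> rw [separates_mk] at h
  · rw [← Finset.card_pair h]
    congr 1
    ext b
    simp only [separates_mk_prop, Finset.mem_filter, Finset.mem_univ, true_and,
      Finset.mem_insert, Finset.mem_singleton]
    grind
  · simp [separates_mk_prop, not_not.1 h]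

open Classical in
/-- The handshake lemma. -/
theorem sum_countP_separates_eq [Fintype β] (B : O → β) (M : Multiset (Sym2 O)) :
    ∑ b, M.countP (Separates (B · = b)) = 2 * M.countP (Separates B) := by
  induction M using Multiset.induction_on with
  | empty => simp
  | cons p M ih =>
    simp only [Multiset.countP_cons, Finset.sum_add_distrib, ih, ← Finset.card_filter,
      card_separates_eq]
    split_ifs <;> ring

open Classical in
theorem exists_separates_and_not_separates_eq [Finite β] {B : O → β} {M M' : Multiset (Sym2 O)}
    (hdeg : ∀ b, M.countP (Separates (B · = b)) = M'.countP (Separates (B · = b))) {b : β}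
    (hM' : ∃ p ∈ M', Separates B p ∧ ¬ Separates (B · = b) p) :
    ∃ p ∈ M, Separates B p ∧ ¬ Separates (B · = b) p := by
  have := Fintype.ofFinite β
  have hsplit (K : Multiset (Sym2 O)) : K.countP (Separates B) = K.countP (Separates (B · = b)) +
      K.countP fun p => Separates B p ∧ ¬ Separates (B · = b) p := by
    rw [Multiset.countP_eq_countP_filter_add _ _ (Separates (B · = b)), Multiset.countP_filter,
      Multiset.countP_filter]
    congr 1
    exact Multiset.countP_congr rfl fun p _ =>
      propext (and_iff_right_of_imp separates_of_separates_eq)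
  have htotal : M.countP (Separates B) = M'.countP (Separates B) := by
    have h := sum_countP_separates_eq B M
    rw [Finset.sum_congr rfl fun b _ => hdeg b, sum_countP_separates_eq] at h
    omega
  rw [← Multiset.countP_pos] at hM' ⊢
  have hM := hsplit M
  have hM'_split := hsplit M'
  have hb := hdeg b
  omega

/-- The congruence `c` allows the exchange of one end in each of two pairs, provided that all the
pairs involved are separated by `B`. -/
def AllowsExchange (c : AddCon (Multiset (Sym2 O))) (B : O → β) : Prop :=
  ∀ i j k l, B i ≠ B k → B i ≠ B l → B j ≠ B k → B j ≠ B l →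
    c {s(i, k), s(j, l)} {s(i, l), s(k, j)}

variable {c : AddCon (Multiset (Sym2 O))} {B : O → β} {M M' : Multiset (Sym2 O)} {i j k l : O}

theorem AllowsExchange.exists_cons_of_ne (hc : AllowsExchange c B) (hij : B i ≠ B j)
    (hik : B i ≠ B k) (hjl : B j ≠ B l) (hkl : B k ≠ B l) (hikM : s(i, k) ∈ M)
    (hjlM : s(j, l) ∈ M) : ∃ K, c M (s(i, j) ::ₘ K) := by
  by_cases hijM : s(i, j) ∈ M
  · obtain ⟨K, rfl⟩ := Multiset.exists_cons_of_mem hijM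
    exact ⟨K, c.refl _⟩
  rw [Sym2.eq_swap] at hjlM
  have hne : s(i, k) ≠ s(l, j) := by
    rintro h
    rcases Sym2.eq_iff.1 h with ⟨-, rfl⟩ | ⟨rfl, -⟩
    · exact hijM hikM
    · exact hij rfl
  obtain ⟨K, -, hK⟩ := exists_addCon_cons_cons
    (hc i l k j hik hij hkl.symm hjl.symm) hikM hjlM hne
  exact ⟨s(k, l) ::ₘ K, hK⟩

open Classical in
/-- If the partners `k` of `i` and `l` of `j` lie in the same class, a separated pair avoiding that
class provides `i` with a partner outside it. -/
theorem AllowsExchange.exists_cons [Finite β] (hc : AllowsExchange c B)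
    (hdeg : ∀ b, M.countP (Separates (B · = b)) = M'.countP (Separates (B · = b)))
    (hij : B i ≠ B j) (hik : B i ≠ B k) (hjl : B j ≠ B l) (hijM' : s(i, j) ∈ M')
    (hikM : s(i, k) ∈ M) (hjlM : s(j, l) ∈ M) : ∃ K, c M (s(i, j) ::ₘ K) := by
  by_cases hkl : B k ≠ B l
  · exact hc.exists_cons_of_ne hij hik hjl hkl hikM hjlM
  rw [not_not] at hkl
  obtain ⟨x, y, hxyM, hxy, hyi, hxk, hyk⟩ : ∃ x y, s(x, y) ∈ M ∧ B x ≠ B y ∧ B y ≠ B i ∧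
      B x ≠ B k ∧ B y ≠ B k := by
    obtain ⟨p, hpM, hp, hpk⟩ := exists_separates_and_not_separates_eq hdeg (b := B k)
      ⟨s(i, j), hijM', separates_mk.2 hij, by rw [separates_mk_prop]; grind⟩
    induction p with | _ x y
    rw [separates_mk] at hp
    rw [separates_mk_prop, not_not] at hpk
    by_cases hyi : B y = B i
    · exact ⟨y, x, Sym2.eq_swap ▸ hpM, by grind⟩
    · exact ⟨x, y, hpM, by grind⟩
  have hne : s(i, k) ≠ s(x, y) := by
    rintro h
    rcases Sym2.eq_iff.1 h with ⟨-, rfl⟩ | ⟨-, rfl⟩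
    exacts [hyk rfl, hxk rfl]
  obtain ⟨K, hMK, hK⟩ := exists_addCon_cons_cons
    (hc i x k y hik hyi.symm hxk hxy) hikM hxyM hne
  have hjlK : s(j, l) ∈ s(i, y) ::ₘ s(k, x) ::ₘ K := by
    have h : s(j, l) ∈ K := by
      rw [hMK, Multiset.mem_cons, Multiset.mem_cons, Sym2.eq_iff, Sym2.eq_iff] at hjlM
      grind
    exact Multiset.mem_cons_of_mem (Multiset.mem_cons_of_mem h)
  obtain ⟨L, hL⟩ := hc.exists_cons_of_ne hij hyi.symm hjl (hkl ▸ hyk)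
    (Multiset.mem_cons_self _ _) hjlK
  exact ⟨L, c.trans hK hL⟩

end Multigraph

section RootedTree

variable {V : Type*} {T : Digraph V} {r u v w x y i j c : V}

/-- The descendants of `w`, including `w` itself. -/
def descendants (T : Digraph V) (w : V) : Set V := {x | Relation.ReflTransGen T.Adj w x}

theorem self_mem_descendants (T : Digraph V) (w : V) : w ∈ descendants T w :=
  Relation.ReflTransGen.refl

theorem mem_descendants_of_adj (hx : x ∈ descendants T w) (h : T.Adj x y) :
    y ∈ descendants T w :=
  Relation.ReflTransGen.tail hx h

theorem mem_descendants_iff_eq_or_exists_child :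
    x ∈ descendants T v ↔ x = v ∨ ∃ w, T.Adj v w ∧ x ∈ descendants T w :=
  Relation.ReflTransGen.cases_head_iff.trans (or_congr_left eq_comm)

theorem mem_descendants_leaf_iff (hv : v ∈ leaves T) : x ∈ descendants T v ↔ x = v := by
  rw [mem_descendants_iff_eq_or_exists_child]
  exact or_iff_left fun ⟨w, h, _⟩ => hv w h

theorem mem_descendants_of_upward (p : T.toSimpleGraphInclusive.Walk x c)
    (hp : ∀ d ∈ p.darts, T.Adj d.snd d.fst) : x ∈ descendants T c := by
  induction p with
  | nil => exact self_mem_descendants T _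
  | cons h p ih =>
    rw [SimpleGraph.Walk.darts_cons, List.forall_mem_cons] at hp
    exact mem_descendants_of_adj (ih hp.2) hp.1

namespace IsAcyclic

theorem notMem_descendants (hT : IsAcyclic T) (h : T.Adj u w) : u ∉ descendants T w :=
  fun hu => hT u (Relation.TransGen.head' h hu)

theorem adj_toSimpleGraphInclusive (hT : IsAcyclic T) (h : T.Adj u w) :
    T.toSimpleGraphInclusive.Adj u w :=
  ⟨fun huw => hT u (.single (huw ▸ h)), .inl h⟩

theorem exists_isPath_upward (hT : IsAcyclic T) (hx : x ∈ descendants T c) :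
    ∃ p : T.toSimpleGraphInclusive.Walk x c, p.IsPath ∧ ∀ d ∈ p.darts, T.Adj d.snd d.fst := by
  classical
  obtain ⟨p, hp⟩ : ∃ p : T.toSimpleGraphInclusive.Walk x c, ∀ d ∈ p.darts, T.Adj d.snd d.fst := by
    induction hx with
    | refl => exact ⟨.nil, by simp⟩
    | tail _ h ih =>
      obtain ⟨p, hp⟩ := ih
      exact ⟨.cons (hT.adj_toSimpleGraphInclusive h).symm p,
        List.forall_mem_cons.2 ⟨h, hp⟩⟩
  exact ⟨p.bypass, p.bypass_isPath, fun d hd => hp d (p.darts_bypass_subset_darts hd)⟩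

end IsAcyclic

namespace Trek

theorem top_eq_iff (hT : IsAcyclic T) {P : Trek T i j} : P.top = c ↔ P.IsTop c := by
  have htop : P.IsTop P.top := @Classical.epsilon_spec V P.IsTop (existsUnique_isTop hT P).exists
  exact ⟨fun h => h ▸ htop, (existsUnique_isTop hT P).unique htop⟩

theorem onLeftSide_reverse_iff {P : Trek T i j} : P.reverse.OnLeftSide c ↔ P.OnRightSide c :=
  ⟨fun h => P.reverse_reverse ▸ h.reverse, OnRightSide.reverse⟩

end Trek

namespace IsRootedDirectedTree

theorem path_unique (hT : IsRootedDirectedTree T r) {p q : T.toSimpleGraphInclusive.Walk i j}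
    (hp : p.IsPath) (hq : q.IsPath) : p = q :=
  (hT.isTree.existsUnique_path i j).unique hp hq

theorem exists_isPath_concat (hT : IsRootedDirectedTree T r) (h : T.Adj x y) :
    ∃ p : T.toSimpleGraphInclusive.Walk r x,
      (p.concat (hT.acyclic.adj_toSimpleGraphInclusive h)).IsPath := by
  classical
  obtain ⟨p, hp, hlength⟩ := hT.isTree.connected.exists_path_of_dist r x
  refine ⟨p, hp.concat (fun hy => ?_) _⟩
  have htake := p.length_takeUntil_le_length hy
  have hdist := SimpleGraph.dist_le (p.takeUntil y hy)
  have haway := hT.away x y h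
  omega

theorem parent_unique (hT : IsRootedDirectedTree T r) (hx : T.Adj x v) (hy : T.Adj y v) :
    x = y := by
  obtain ⟨p, hp⟩ := hT.exists_isPath_concat hx
  obtain ⟨q, hq⟩ := hT.exists_isPath_concat hy
  exact (SimpleGraph.Walk.concat_inj (hT.path_unique hp hq)).1

theorem not_adj_root (hT : IsRootedDirectedTree T r) (x : V) : ¬ T.Adj x r := by
  intro h
  have haway := hT.away x r h
  simp at haway

theorem mem_descendants_iff_of_adj (hT : IsRootedDirectedTree T r) (h : T.Adj x y) :
    y ∈ descendants T w ↔ x ∈ descendants T w ∨ y = w := by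
  refine ⟨fun hy => ?_, ?_⟩
  · rcases Relation.ReflTransGen.cases_tail hy with rfl | ⟨x', hx', h'⟩
    · exact .inr rfl
    · exact .inl (hT.parent_unique h' h ▸ hx')
  · rintro (hx | rfl)
    exacts [mem_descendants_of_adj hx h, self_mem_descendants T y]

theorem mem_descendants_root (hT : IsRootedDirectedTree T r) (x : V) : x ∈ descendants T r := by
  have hreach := (SimpleGraph.reachable_iff_reflTransGen r x).1 (hT.isTree.connected r x)
  induction hreach with
  | refl => exact self_mem_descendants T r
  | @tail x y _ hxy hx =>
    rcases hxy.2 with h | h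
    · exact mem_descendants_of_adj hx h
    · refine ((hT.mem_descendants_iff_of_adj h).1 hx).resolve_right ?_
      rintro rfl
      exact hT.not_adj_root _ h

theorem exists_parent (hT : IsRootedDirectedTree T r) (hv : v ≠ r) : ∃ u, T.Adj u v := by
  rcases Relation.ReflTransGen.cases_tail (hT.mem_descendants_root v) with h | ⟨u, -, h⟩
  exacts [absurd h hv, ⟨u, h⟩]

theorem child_unique (hT : IsRootedDirectedTree T r) {w w' : V} (hw : T.Adj v w)
    (hw' : T.Adj v w') (hx : x ∈ descendants T w) (hx' : x ∈ descendants T w') : w = w' := by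
  have hmem {w w' : V} (hw : T.Adj v w) (hw' : T.Adj v w') (h : w' ∈ descendants T w) : w = w' :=
    (((hT.mem_descendants_iff_of_adj hw').1 h).resolve_left
      (hT.acyclic.notMem_descendants hw)).symm
  have hparent : Relator.RightUnique (Function.swap T.Adj) := fun _ _ _ => hT.parent_unique
  rcases Relation.ReflTransGen.total_of_right_unique hparent
    (Relation.reflTransGen_swap.2 hx) (Relation.reflTransGen_swap.2 hx') with h | h
  · exact (hmem hw' hw (Relation.reflTransGen_swap.1 h)).symm
  · exact hmem hw hw' (Relation.reflTransGen_swap.1 h)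

theorem eq_edge_iff_of_adj (hT : IsRootedDirectedTree T r) (huw : T.Adj u w) (h : T.Adj x y) :
    s(u, w) = s(x, y) ↔ ¬ (x ∈ descendants T w ↔ y ∈ descendants T w) := by
  have hu := hT.acyclic.notMem_descendants huw
  have hw := self_mem_descendants T w
  refine ⟨fun he => ?_, fun hne => ?_⟩
  · rcases Sym2.eq_iff.1 he with ⟨rfl, rfl⟩ | ⟨rfl, rfl⟩ <;> tauto
  · rw [hT.mem_descendants_iff_of_adj h] at hne
    obtain rfl : y = w := by tauto
    rw [hT.parent_unique h huw]

theorem eq_edge_iff (hT : IsRootedDirectedTree T r) (huw : T.Adj u w)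
    (h : T.toSimpleGraphInclusive.Adj x y) :
    s(u, w) = s(x, y) ↔ ¬ (x ∈ descendants T w ↔ y ∈ descendants T w) := by
  rcases h.2 with h | h
  · exact hT.eq_edge_iff_of_adj huw h
  · rw [Sym2.eq_swap (a := x), hT.eq_edge_iff_of_adj huw h, iff_comm (a := x ∈ _)]

theorem mem_edges_iff (hT : IsRootedDirectedTree T r) (huw : T.Adj u w)
    {p : T.toSimpleGraphInclusive.Walk i j} (hp : p.IsTrail) :
    s(u, w) ∈ p.edges ↔ ¬ (i ∈ descendants T w ↔ j ∈ descendants T w) := by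
  induction p with
  | nil => simp
  | @cons x y z h p ih =>
    rw [SimpleGraph.Walk.isTrail_cons] at hp
    have hnotMem : s(u, w) = s(x, y) → s(u, w) ∉ p.edges := fun he => he ▸ hp.2
    rw [ih hp.1, hT.eq_edge_iff huw h] at hnotMem
    rw [SimpleGraph.Walk.edges_cons, List.mem_cons, ih hp.1, hT.eq_edge_iff huw h]
    tauto

theorem onLeftSide_iff (hT : IsRootedDirectedTree T r) {P : Trek T i j} :
    P.OnLeftSide c ↔ c ∈ P.1.support ∧ i ∈ descendants T c := by
  classical
  constructor
  · rintro ⟨p, q, hP, hp⟩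
    exact ⟨by simp [hP], mem_descendants_of_upward p hp⟩
  · rintro ⟨hc, hi⟩
    obtain ⟨p, hp, hup⟩ := hT.acyclic.exists_isPath_upward hi
    refine ⟨P.1.takeUntil c hc, P.1.dropUntil c hc, (P.1.take_spec hc).symm, ?_⟩
    rwa [hT.path_unique (P.2.1.takeUntil hc) hp]

theorem onRightSide_iff (hT : IsRootedDirectedTree T r) {P : Trek T i j} :
    P.OnRightSide c ↔ c ∈ P.1.support ∧ j ∈ descendants T c := by
  rw [← Trek.onLeftSide_reverse_iff, hT.onLeftSide_iff]
  simp [Trek.reverse]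

theorem top_eq_leaf_iff (hT : IsRootedDirectedTree T r) {P : Trek T i j} (hv : v ∈ leaves T) :
    P.top = v ↔ i = v ∧ j = v := by
  rw [Trek.top_eq_iff hT.acyclic, Trek.IsTop, hT.onLeftSide_iff, hT.onRightSide_iff,
    mem_descendants_leaf_iff hv, mem_descendants_leaf_iff hv]
  refine ⟨fun h => ⟨h.1.2, h.2.2⟩, ?_⟩
  rintro ⟨rfl, rfl⟩
  exact ⟨⟨P.1.start_mem_support, rfl⟩, P.1.end_mem_support, rfl⟩

/-- The only trek between two vertices of a rooted directed tree. -/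
def trek (hT : IsRootedDirectedTree T r) (i j : V) : Trek T i j :=
  ⟨(hT.isTree.existsUnique_path i j).choose, (hT.isTree.existsUnique_path i j).choose_spec.1,
    fun ⟨_, _, _, hne, hx, hy, _, _⟩ => hne (hT.parent_unique hx hy)⟩

theorem trek_eq (hT : IsRootedDirectedTree T r) (P : Trek T i j) : hT.trek i j = P :=
  Subtype.ext (hT.path_unique (hT.trek i j).2.1 P.2.1)

end IsRootedDirectedTree

/-- The branch at `v` containing `x`, encoded as the set of all children of `v` above `x`. In a
rooted tree this is a singleton if `x` is a proper descendant of `v` and empty otherwise. -/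
def branch (T : Digraph V) (v x : V) : Set V := {w | T.Adj v w ∧ x ∈ descendants T w}

theorem branch_eq_empty_of_notMem_descendants (hx : x ∉ descendants T v) : branch T v x = ∅ :=
  Set.eq_empty_of_forall_notMem fun w hw =>
    hx (mem_descendants_iff_eq_or_exists_child.2 (.inr ⟨w, hw⟩))

theorem branch_eq_empty_iff (hv : v ∉ leaves T) (hx : x ∈ leaves T) :
    branch T v x = ∅ ↔ x ∉ descendants T v := by
  refine ⟨fun h hmem => ?_, branch_eq_empty_of_notMem_descendants⟩
  rcases mem_descendants_iff_eq_or_exists_child.1 hmem with rfl | ⟨w, hw⟩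
  exacts [hv hx, Set.notMem_empty w (h ▸ hw)]

namespace IsRootedDirectedTree

theorem branch_eq_singleton_iff (hT : IsRootedDirectedTree T r) (hw : T.Adj v w) :
    branch T v x = {w} ↔ x ∈ descendants T w := by
  refine ⟨fun h => (h.ge rfl).2, fun hx => Set.eq_singleton_iff_unique_mem.2 ⟨⟨hw, hx⟩, ?_⟩⟩
  exact fun w' hw' => hT.child_unique hw'.1 hw hw'.2 hx

theorem mem_support_of_branch_ne (hT : IsRootedDirectedTree T r)
    (hne : branch T v i ≠ branch T v j) (P : Trek T i j) : v ∈ P.1.support := by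
  obtain ⟨w, hw, hij⟩ : ∃ w, T.Adj v w ∧ ¬ (i ∈ descendants T w ↔ j ∈ descendants T w) := by
    by_contra! h
    exact hne (Set.ext fun w => and_congr_right (h w))
  exact P.1.fst_mem_support_of_mem_edges ((hT.mem_edges_iff hw P.2.1.isTrail).2 hij)

theorem isChokePoint_of_branch_ne (hT : IsRootedDirectedTree T r) {I J : Set V}
    (hne : ∀ x ∈ I, ∀ y ∈ J, branch T v x ≠ branch T v y) : IsChokePoint T v I J := by
  have hmem := fun x hx y hy => hT.mem_support_of_branch_ne (hne x hx y hy)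
  refine ⟨hmem, ?_⟩
  by_cases hI : I ⊆ descendants T v
  · exact .inl fun x hx y hy P => hT.onLeftSide_iff.2 ⟨hmem x hx y hy P, hI hx⟩
  · obtain ⟨x₀, hx₀, hx₀v⟩ := Set.not_subset.1 hI
    refine .inr fun x hx y hy P => hT.onRightSide_iff.2 ⟨hmem x hx y hy P, ?_⟩
    by_contra hyv
    exact hne x₀ hx₀ y hy ((branch_eq_empty_of_notMem_descendants hx₀v).trans
      (branch_eq_empty_of_notMem_descendants hyv).symm)

/-- A branch at `v` is a set of descendants, or the complement of one, or contains no leaf. -/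
theorem exists_separates_branch_eq_iff (hT : IsRootedDirectedTree T r) (hv : v ∉ leaves T)
    (b : Set V) : ∃ w, ∀ p : Sym2 (leaves T), Separates (fun x : leaves T => branch T v x = b) p ↔
      Separates (fun x : leaves T => (x : V) ∈ descendants T w) p := by
  by_cases hb : ∃ x₀ : leaves T, branch T v x₀ = b
  · obtain ⟨x₀, rfl⟩ := hb
    rcases Set.eq_empty_or_nonempty (branch T v x₀) with hempty | ⟨w, hw, hx₀⟩
    · refine ⟨v, fun p => ?_⟩
      induction p with | _ x y
      simp only [separates_mk_prop, hempty, branch_eq_empty_iff hv (Subtype.prop _), not_iff_not]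
    · refine ⟨w, fun p => ?_⟩
      simp only [(hT.branch_eq_singleton_iff hw).2 hx₀, hT.branch_eq_singleton_iff hw]
  · refine ⟨r, fun p => ?_⟩
    induction p with | _ x y
    simp only [not_exists.1 hb, hT.mem_descendants_root, separates_mk_prop, iff_self,
      not_true_eq_false]

end IsRootedDirectedTree

end RootedTree

section TrekExponent

variable {V : Type*} [Fintype V] {T : Digraph V} {r i j k l c : V}

open Classical in
/-- The exponent vector of the product of the `λ_{kl}` over the edges `k → l` of a walk, taken with
multiplicity, so that it is additive under concatenation of walks. -/
def edgeExponent (p : T.toSimpleGraphInclusive.Walk i j) : V ⊕ Edge T →₀ ℕ :=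
  ∑ e : Edge T, Finsupp.single (Sum.inr e) (p.edges.count s(e.1.1, e.1.2))

theorem edgeExponent_append (p : T.toSimpleGraphInclusive.Walk i j)
    (q : T.toSimpleGraphInclusive.Walk j k) :
    edgeExponent (p.append q) = edgeExponent p + edgeExponent q := by
  simp only [edgeExponent, SimpleGraph.Walk.edges_append, List.count_append, Finsupp.single_add,
    Finset.sum_add_distrib]

theorem edgeExponent_reverse (p : T.toSimpleGraphInclusive.Walk i j) :
    edgeExponent p.reverse = edgeExponent p := by
  simp only [edgeExponent, SimpleGraph.Walk.edges_reverse, List.count_reverse]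

namespace Trek

/-- The exponent vector of the monomial of a trek. -/
def exponent (P : Trek T i j) : V ⊕ Edge T →₀ ℕ :=
  Finsupp.single (Sum.inl P.top) 1 + edgeExponent P.1

open Classical in
theorem exponent_inl (P : Trek T i j) (v : V) :
    P.exponent (Sum.inl v) = if P.top = v then 1 else 0 := by
  simp [exponent, edgeExponent, Finsupp.single_apply]

open Classical in
theorem exponent_inr (P : Trek T i j) (e : Edge T) :
    P.exponent (Sum.inr e) = if s(e.1.1, e.1.2) ∈ P.1.edges then 1 else 0 := by
  simp [exponent, edgeExponent, Finsupp.single_apply, P.2.1.isTrail.edges_nodup.count]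

theorem exponent_reverse (P : Trek T i j) : P.reverse.exponent = P.exponent := by
  rw [exponent, exponent, top_reverse, Trek.reverse, edgeExponent_reverse]

theorem trekMonomial_eq_monomial_exponent (P : Trek T i j) :
    trekMonomial P = monomial P.exponent 1 := by
  classical
  have hedge (e : Edge T) :
      monomial (Finsupp.single (Sum.inr e : V ⊕ Edge T) (P.1.edges.count s(e.1.1, e.1.2))) (1 : ℂ) =
        if s(e.1.1, e.1.2) ∈ P.1.edges then X (Sum.inr e) else 1 := by
    rw [← X_pow_eq_monomial, P.2.1.isTrail.edges_nodup.count]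
    split_ifs <;> simp
  rw [exponent, ← mul_one (1 : ℂ), ← monomial_mul, edgeExponent, monomial_sum_one,
    Finset.prod_congr rfl fun e _ => hedge e, ← Finset.prod_filter]
  unfold trekMonomial X
  congr

theorem exponent_of_eq_append (hT : IsAcyclic T) {P : Trek T i j} {Q : Trek T c j}
    {p : T.toSimpleGraphInclusive.Walk i c} (hP : P.1 = p.append Q.1)
    (hp : ∀ d ∈ p.darts, T.Adj d.snd d.fst) : P.exponent = edgeExponent p + Q.exponent := by
  have htop : P.top = Q.top := by
    obtain ⟨⟨q₁, s₁, h₁, hq₁⟩, q₂, s₂, h₂, hs₂⟩ := (top_eq_iff hT (P := Q)).1 rfl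
    refine (top_eq_iff hT).2 ⟨⟨p.append q₁, s₁, ?_, ?_⟩, p.append q₂, s₂, ?_, hs₂⟩
    · rw [hP, h₁, SimpleGraph.Walk.append_assoc]
    · intro d hd
      rw [SimpleGraph.Walk.darts_append, List.mem_append] at hd
      exact hd.elim (hp d) (hq₁ d)
    · rw [hP, h₂, SimpleGraph.Walk.append_assoc]
  rw [exponent, exponent, htop, hP, edgeExponent_append, add_left_comm]

end Trek

namespace IsRootedDirectedTree

theorem exponent_trek_of_onLeftSide (hT : IsRootedDirectedTree T r)
    (h : (hT.trek i j).OnLeftSide c) :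
    (hT.trek i j).exponent = edgeExponent (hT.trek i c).1 + (hT.trek c j).exponent := by
  obtain ⟨p, q, hP, hp⟩ := h
  have hpath : (p.append q).IsPath := hP ▸ (hT.trek i j).2.1
  obtain rfl := hT.path_unique hpath.of_append_left (hT.trek i c).2.1
  obtain rfl := hT.path_unique hpath.of_append_right (hT.trek c j).2.1
  exact Trek.exponent_of_eq_append hT.acyclic hP hp

/-- The exponent vector of the monomial `φ_T(σ_p)`. -/
def pairExponent (hT : IsRootedDirectedTree T r) : Sym2 V → V ⊕ Edge T →₀ ℕ :=
  Sym2.lift ⟨fun i j => (hT.trek i j).exponent, fun i j => by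
    beta_reduce
    rw [hT.trek_eq (hT.trek i j).reverse, Trek.exponent_reverse]⟩

theorem pairExponent_mk (hT : IsRootedDirectedTree T r) (i j : V) :
    hT.pairExponent s(i, j) = (hT.trek i j).exponent := rfl

theorem trekHom_X (hT : IsRootedDirectedTree T r) (p : Sym2 V) :
    trekHom T (X p) = monomial (hT.pairExponent p) 1 := by
  induction p with | _ i j
  have : Subsingleton (Trek T i j) := ⟨fun P Q => (hT.trek_eq P).symm.trans (hT.trek_eq Q)⟩
  have hsum : trekPolynomial T i j = trekMonomial (hT.trek i j) := Fintype.sum_subsingleton _ _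
  rw [pairExponent_mk, ← Trek.trekMonomial_eq_monomial_exponent, ← hsum]
  exact aeval_X _ _

theorem pairExponent_add_pairExponent_of_onLeftSide (hT : IsRootedDirectedTree T r)
    (h : ∀ x ∈ ({i, j} : Set V), ∀ y ∈ ({k, l} : Set V), ∀ P : Trek T x y, P.OnLeftSide c) :
    hT.pairExponent s(i, k) + hT.pairExponent s(j, l) =
      hT.pairExponent s(i, l) + hT.pairExponent s(k, j) := by
  rw [Sym2.eq_swap (a := k)]
  simp only [pairExponent_mk]
  rw [hT.exponent_trek_of_onLeftSide (h i (by simp) k (by simp) _),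
    hT.exponent_trek_of_onLeftSide (h j (by simp) l (by simp) _),
    hT.exponent_trek_of_onLeftSide (h i (by simp) l (by simp) _),
    hT.exponent_trek_of_onLeftSide (h j (by simp) k (by simp) _)]
  abel

theorem pairExponent_add_pairExponent_of_isChokePoint (hT : IsRootedDirectedTree T r)
    (h : IsChokePoint T c {i, j} {k, l}) :
    hT.pairExponent s(i, k) + hT.pairExponent s(j, l) =
      hT.pairExponent s(i, l) + hT.pairExponent s(k, j) := by
  rcases h.2 with h | h
  · exact hT.pairExponent_add_pairExponent_of_onLeftSide h
  · have hswap := hT.pairExponent_add_pairExponent_of_onLeftSide (i := k) (j := l) (k := i)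
      (l := j) fun y hy x hx P => P.reverse_reverse ▸ (h x hx y hy P.reverse).reverse
    rw [Sym2.eq_swap (a := i), Sym2.eq_swap (a := j), hswap, add_comm, Sym2.eq_swap (a := i)]

/-- The exponent vector of the monomial `φ_T(σ_p)` for a pair `p` of leaves. -/
def leafExponent (hT : IsRootedDirectedTree T r) (p : Sym2 (leaves T)) : V ⊕ Edge T →₀ ℕ :=
  hT.pairExponent (p.map (↑))

open Classical in
theorem leafExponent_inl (hT : IsRootedDirectedTree T r) (p : Sym2 (leaves T)) (v : leaves T) :
    hT.leafExponent p (Sum.inl v) = if p = s(v, v) then 1 else 0 := by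
  induction p with | _ i j
  rw [leafExponent, Sym2.map_mk, pairExponent_mk, Trek.exponent_inl]
  refine if_congr ?_ rfl rfl
  rw [hT.top_eq_leaf_iff v.2, Sym2.eq_iff]
  simp only [Subtype.ext_iff, or_self]

open Classical in
theorem leafExponent_inr (hT : IsRootedDirectedTree T r) (p : Sym2 (leaves T)) (e : Edge T) :
    hT.leafExponent p (Sum.inr e) =
      if Separates (fun x : leaves T => (x : V) ∈ descendants T e.1.2) p then 1 else 0 := by
  induction p with | _ i j
  rw [leafExponent, Sym2.map_mk, pairExponent_mk, Trek.exponent_inr]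
  refine if_congr ?_ rfl rfl
  rw [hT.mem_edges_iff e.2 (hT.trek i j).2.1.isTrail, separates_mk_prop]

theorem observedIdeal_leaves_eq_ker (hT : IsRootedDirectedTree T r) :
    observedIdeal T (leaves T) =
      RingHom.ker (aeval fun p => monomial (hT.leafExponent p) (1 : ℂ)) := by
  have hcomp : (trekHom T).comp (rename (Sym2.map (↑))) =
      aeval fun p : Sym2 (leaves T) => monomial (hT.leafExponent p) (1 : ℂ) := by
    ext1 p
    rw [AlgHom.comp_apply, rename_X, hT.trekHom_X, aeval_X, leafExponent]
  rw [← hcomp]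
  rfl

variable {M M' : Multiset (Sym2 (leaves T))}

open Classical in
theorem countP_separates_descendants_eq (hT : IsRootedDirectedTree T r)
    (h : weight hT.leafExponent M = weight hT.leafExponent M') (w : V) :
    M.countP (Separates fun x : leaves T => (x : V) ∈ descendants T w) =
      M'.countP (Separates fun x : leaves T => (x : V) ∈ descendants T w) := by
  by_cases hw : w = r
  · have hzero (p : Sym2 (leaves T)) :
        ¬ Separates (fun x : leaves T => (x : V) ∈ descendants T w) p := by
      induction p with | _ x y
      simp [separates_mk_prop, hw, hT.mem_descendants_root]
    rw [Multiset.countP_eq_zero.2 fun p _ => hzero p, Multiset.countP_eq_zero.2 fun p _ => hzero p]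
  · obtain ⟨u, hu⟩ := hT.exists_parent hw
    have hcount := weight_apply_eq_countP fun p => hT.leafExponent_inr p ⟨(u, w), hu⟩
    rw [← hcount, ← hcount, h]

open Classical in
theorem countP_separates_branch_eq (hT : IsRootedDirectedTree T r)
    (h : weight hT.leafExponent M = weight hT.leafExponent M') {v : V} (hv : v ∉ leaves T)
    (b : Set V) : M.countP (Separates fun x : leaves T => branch T v x = b) =
      M'.countP (Separates fun x : leaves T => branch T v x = b) := by
  obtain ⟨w, hw⟩ := hT.exists_separates_branch_eq_iff hv b
  simp only [hw, hT.countP_separates_descendants_eq h w]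

theorem loop_mem_of_weight_eq (hT : IsRootedDirectedTree T r)
    (h : weight hT.leafExponent M = weight hT.leafExponent M') {v : leaves T}
    (hv : s(v, v) ∈ M') : s(v, v) ∈ M := by
  classical
  have hcount := weight_apply_eq_countP fun p => hT.leafExponent_inl p v
  have heq : M.countP (· = s(v, v)) = M'.countP (· = s(v, v)) := by rw [← hcount, ← hcount, h]
  obtain ⟨p, hp, rfl⟩ : ∃ p ∈ M, p = s(v, v) := by
    rw [← Multiset.countP_pos, heq, Multiset.countP_pos]
    exact ⟨_, hv, rfl⟩
  exact hp

theorem exists_mem_of_weight_eq (hT : IsRootedDirectedTree T r)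
    (h : weight hT.leafExponent M = weight hT.leafExponent M') {i j : leaves T} (hij : i ≠ j)
    (hM' : s(i, j) ∈ M') : ∃ k, s(i, k) ∈ M := by
  classical
  have hleaf (x : leaves T) : (x : V) ∈ descendants T i ↔ x = i := by
    rw [mem_descendants_leaf_iff i.2, Subtype.ext_iff]
  have heq := hT.countP_separates_descendants_eq h i
  obtain ⟨p, hp, hsep⟩ : ∃ p ∈ M, Separates (fun x : leaves T => (x : V) ∈ descendants T i) p := by
    rw [← Multiset.countP_pos, heq, Multiset.countP_pos]
    exact ⟨_, hM', by simp [separates_mk_prop, hleaf, hij.symm]⟩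
  induction p with | _ x y
  rw [separates_mk_prop, hleaf, hleaf] at hsep
  by_cases hx : x = i
  · exact ⟨y, hx ▸ hp⟩
  · obtain rfl : y = i := by tauto
    exact ⟨x, Sym2.eq_swap ▸ hp⟩

end IsRootedDirectedTree

end TrekExponent

section TetradMove

variable {V : Type*} {T : Digraph V} {r v : V}

theorem IsAcyclic.exists_and_forall_adj_not [Finite V] (hT : IsAcyclic T) {P : V → Prop}
    (hP : ∃ v, P v) : ∃ v, P v ∧ ∀ w, T.Adj v w → ¬ P w := by
  have hirrefl : Std.Irrefl (Function.swap (Relation.TransGen T.Adj)) := ⟨hT⟩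
  have htrans : IsTrans V (Function.swap (Relation.TransGen T.Adj)) :=
    ⟨fun _ _ _ h h' => h'.trans h⟩
  obtain ⟨v, hv, hmin⟩ := (Finite.wellFounded_of_trans_of_irrefl
    (Function.swap (Relation.TransGen T.Adj))).has_min {v | P v} hP
  exact ⟨v, hv, fun w hvw hw => hmin w hw (.single hvw)⟩

/-- The move replacing `σ_{ik} σ_{jl}` by `σ_{il} σ_{kj}` for a tetrad of leaves of `T` with a choke
point, on the multisets of pairs which encode monomials. -/
def IsTetradMove (T : Digraph V) (M N : Multiset (Sym2 (leaves T))) : Prop :=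
  ∃ i j k l : leaves T, (∃ c, IsChokePoint T c {(i : V), (j : V)} {(k : V), (l : V)}) ∧
    M = {s(i, k), s(j, l)} ∧ N = {s(i, l), s(k, j)}

theorem IsRootedDirectedTree.allowsExchange_branch (hT : IsRootedDirectedTree T r) (v : V) :
    AllowsExchange (addConGen (IsTetradMove T)) fun x : leaves T => branch T v x := by
  intro i j k l hik hil hjk hjl
  refine .of _ _ ⟨i, j, k, l, ⟨v, hT.isChokePoint_of_branch_ne ?_⟩, rfl, rfl⟩
  rintro x (rfl | rfl) y (rfl | rfl) <;> assumption

variable [Fintype V]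

namespace IsRootedDirectedTree

theorem addConGen_isTetradMove_le_ker_weight (hT : IsRootedDirectedTree T r) :
    addConGen (IsTetradMove T) ≤ AddCon.ker (weight hT.leafExponent) := by
  refine AddCon.addConGen_le.2 ?_
  rintro _ _ ⟨i, j, k, l, ⟨c, hc⟩, rfl, rfl⟩
  rw [AddCon.ker_rel, Multiset.insert_eq_cons, Multiset.insert_eq_cons, weight_cons, weight_cons,
    weight_singleton, weight_singleton]
  exact hT.pairExponent_add_pairExponent_of_isChokePoint hc

variable {M M' : Multiset (Sym2 (leaves T))}

/-- By the minimality of `v`, all pairs which meet the descendants of `v` are separated by the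
branches at `v`. -/
theorem exists_cons_of_forall_adj (hT : IsRootedDirectedTree T r)
    (h : weight hT.leafExponent M = weight hT.leafExponent M')
    (hmin : ∀ w, T.Adj v w → ¬ ∃ q ∈ M + M', ∀ x ∈ q, (x : V) ∈ descendants T w)
    {p : Sym2 (leaves T)} (hpM' : p ∈ M') (hp : ∀ x ∈ p, (x : V) ∈ descendants T v) :
    ∃ K, addConGen (IsTetradMove T) M (p ::ₘ K) := by
  induction p with | _ i j
  obtain ⟨hi, hj⟩ : (i : V) ∈ descendants T v ∧ (j : V) ∈ descendants T v :=
    ⟨hp i (Sym2.mem_mk_left i j), hp j (Sym2.mem_mk_right i j)⟩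
  by_cases hv : v ∈ leaves T
  · obtain rfl : i = j := Subtype.ext <|
      ((mem_descendants_leaf_iff hv).1 hi).trans ((mem_descendants_leaf_iff hv).1 hj).symm
    obtain ⟨K, rfl⟩ := Multiset.exists_cons_of_mem (hT.loop_mem_of_weight_eq h hpM')
    exact ⟨K, AddCon.refl _ _⟩
  have hsep {x y : leaves T} (hxy : s(x, y) ∈ M + M') (hx : (x : V) ∈ descendants T v) :
      branch T v x ≠ branch T v y := by
    intro heq
    obtain hxv | ⟨w, hw, hxw⟩ := mem_descendants_iff_eq_or_exists_child.1 hx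
    · exact hv (hxv ▸ x.2)
    · exact hmin w hw ⟨_, hxy, Sym2.ball.2 ⟨hxw, (heq.le ⟨hw, hxw⟩).2⟩⟩
  have hij : branch T v i ≠ branch T v j := hsep (Multiset.mem_add.2 (.inr hpM')) hi
  have hne : i ≠ j := fun hij' => hij (by rw [hij'])
  obtain ⟨k, hk⟩ := hT.exists_mem_of_weight_eq h hne hpM'
  obtain ⟨l, hl⟩ := hT.exists_mem_of_weight_eq h hne.symm (Sym2.eq_swap ▸ hpM')
  exact (hT.allowsExchange_branch v).exists_cons (hT.countP_separates_branch_eq h hv) hij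
    (hsep (Multiset.mem_add.2 (.inl hk)) hi) (hsep (Multiset.mem_add.2 (.inl hl)) hj) hpM' hk hl

theorem exists_common_cons (hT : IsRootedDirectedTree T r)
    (h : weight hT.leafExponent M = weight hT.leafExponent M') (hne : M + M' ≠ 0) :
    ∃ p K K', addConGen (IsTetradMove T) M (p ::ₘ K) ∧
      addConGen (IsTetradMove T) M' (p ::ₘ K') := by
  obtain ⟨v, ⟨p, hpMM', hp⟩, hmin⟩ := hT.acyclic.exists_and_forall_adj_not
    (P := fun v => ∃ p ∈ M + M', ∀ x ∈ p, (x : V) ∈ descendants T v) <| by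
      obtain ⟨p, hp⟩ := Multiset.exists_mem_of_ne_zero hne
      exact ⟨r, p, hp, fun x _ => hT.mem_descendants_root x⟩
  rcases Multiset.mem_add.1 hpMM' with hpM | hpM'
  · obtain ⟨K, rfl⟩ := Multiset.exists_cons_of_mem hpM
    obtain ⟨K', hK'⟩ := hT.exists_cons_of_forall_adj h.symm (by rwa [add_comm]) hpM hp
    exact ⟨p, K, K', AddCon.refl _ _, hK'⟩
  · obtain ⟨K', rfl⟩ := Multiset.exists_cons_of_mem hpM'
    obtain ⟨K, hK⟩ := hT.exists_cons_of_forall_adj h hmin hpM' hp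
    exact ⟨p, K, K', hK, AddCon.refl _ _⟩

theorem addConGen_isTetradMove_eq_ker_weight (hT : IsRootedDirectedTree T r) :
    addConGen (IsTetradMove T) = AddCon.ker (weight hT.leafExponent) := by
  have hcard : addConGen (IsTetradMove T) ≤ AddCon.ker Multiset.cardHom := by
    refine AddCon.addConGen_le.2 ?_
    rintro _ _ ⟨i, j, k, l, -, rfl, rfl⟩
    simp only [AddCon.ker_rel, Multiset.cardHom_apply, Multiset.card_pair]
  exact le_antisymm hT.addConGen_isTetradMove_le_ker_weight <|
    ker_weight_le_of_exists_common_mem hT.addConGen_isTetradMove_le_ker_weight hcard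
      fun _ _ => hT.exists_common_cons

end IsRootedDirectedTree

theorem tetrad_eq_sub {O : Type*} (i j k l : O) : tetrad i j k l =
    multisetMonomial ℂ {s(i, k), s(j, l)} - multisetMonomial ℂ {s(i, l), s(k, j)} := by
  rw [tetrad, multisetMonomial_pair, multisetMonomial_pair]

end TetradMove

end GaussianNetwork

end

theorem mainTheorem3 {V : Type*} [Fintype V] (T : Digraph V) (r : V)
    (hT : GaussianNetwork.IsRootedDirectedTree T r) :
    GaussianNetwork.observedIdeal T (GaussianNetwork.leaves T) =
      Ideal.span {f | ∃ i j k l : GaussianNetwork.leaves T,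
        (∃ c : V, GaussianNetwork.IsChokePoint T c {(i : V), (j : V)} {(k : V), (l : V)}) ∧
          f = GaussianNetwork.tetrad i j k l} := by
  rw [hT.observedIdeal_leaves_eq_ker, GaussianNetwork.ker_aeval_monomial_eq_span
    hT.addConGen_isTetradMove_eq_ker_weight]
  congr 1
  ext f
  constructor
  · rintro ⟨_, _, ⟨i, j, k, l, hc, rfl, rfl⟩, rfl⟩
    exact ⟨i, j, k, l, hc, (GaussianNetwork.tetrad_eq_sub i j k l).symm⟩
  · rintro ⟨i, j, k, l, hc, rfl⟩
    exact ⟨_, _, ⟨i, j, k, l, hc, rfl, rfl⟩, GaussianNetwork.tetrad_eq_sub i j k l⟩
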